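/- Let $\Gamma=\mathrm{PSL}(2,\mathbf Z)$ act on the hyperbolic plane $\mathbf H^2$ by Möbius transformations and let $X=\mathbf H^2/\Gamma$ be the modular surface. An element $\gamma\in\Gamma$ is hyperbolic if $|\mathrm{Tr}(\gamma)|>2$, and primitive if it is not of the form $\eta^j$ with $\eta\in\Gamma$, $j\ge 2$. The lengths of closed geodesics of $X$ representing (the conjugacy class of) $\gamma$ are the numbers $L>0$ for which there is a unit-speed geodesic $c\colon\mathbf R\to\mathbf H^2$ with $c(t+L)=\gamma c(t)$ for all $t$; if $\gamma$ is hyperbolic there is exactly one such number, written $\ell(c_\gamma)$. The primitive length spectrum $\mathcal L_p(X)$ is the set of all lengths of closed geodesics representing primitive elements of $\Gamma$. A hyperbolic $\gamma\in\Gamma$ with eigenvalue $\lambda_\gamma$ (defined up to sign and inversion), generating the real quadratic field $K_\gamma=\mathbf Q(\lambda_\gamma)$, is absolutely primitive if $\lambda_\gamma$ is a fundamental unit in the group $\mathcal O_{K_\gamma}^1$ of units of norm $1$ of the ring of integers of $K_\gamma$, i.e. if every element of $\mathcal O_{K_\gamma}^1$ is $\pm\lambda_\gamma^j$ for some $j\in\mathbf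 Z$. For a positive integer $m$ let $\eta_m\in\mathrm{PGL}(2,\mathbf Q)$ be the class of $\mathrm{diag}(1,m)$. (1) Let $\gamma\in\Gamma$ be absolutely primitive and $\ell=\ell(c_\gamma)$. For every $k\in\mathbf N$ there is a positive integer $C$ such that $$\{C\ell n : n=1,\dots,k\}\subset\mathcal L_p(X).$$ Moreover $C$ can be chosen so that for each $1\le n\le k$ there is a positive integer $m$ for which $\theta=\eta_m\gamma^{Cn}\eta_m^{-1}$ lies in $\Gamma$, is primitive, and satisfies $\ell(c_\theta)=C\ell n$. (2) Let $\gamma\in\Gamma$ be primitive and hyperbolic and $\ell=\ell(c_\gamma)$. There is a positive integer $D$, depending only on $\gamma$, such that for every $k\in\mathbf N$ there is a positive rational number $C$ with $CD\in\mathbf N$ and $$\{C\ell n : n=1,\dots,k\}\subset\mathcal L_p(X).$$ -/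

import Mathlib

open scoped MatrixGroups UpperHalfPlane NumberField IntermediateField

noncomputable section

namespace ModularSurface

/-- The canonical homomorphism `PSL(2, ℤ) → PGL(2, R)`. -/
def toPGL (R : Type) [CommRing R] : PSL(2, ℤ) →* PGL(2, R) :=
  (Matrix.ProjGenLinGroup.map (Int.castRingHom R)).comp Matrix.ProjectiveSpecialLinearGroup.toPGL

/-- The set of lengths of the closed (orbifold) geodesics on `ℍ / PSL(2, ℤ)` that represent the
conjugacy class of `g`. Such a geodesic lifts to a complete unit-speed geodesic `c` of the
hyperbolic plane (equivalently, to a distance-preserving map `ℝ → ℍ`) which `g` translates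
along itself by the length `L > 0`. Here `g` acts on `ℍ` by its Möbius transformation. -/
def closedGeodesicLengths (g : PSL(2, ℤ)) : Set ℝ :=
  {L | 0 < L ∧ ∃ c : ℝ → ℍ, Isometry c ∧ ∀ t : ℝ, c (t + L) = toPGL ℝ g • c t}

/-- An element of a group is primitive if it is not a proper power. (Such an element has infinite
order, since `g = g ^ (n + 1)` if `g ^ n = 1`, and `1 = 1 ^ 2`.) -/
def IsPrimitive {G : Type*} [Group G] (g : G) : Prop :=
  ∀ (h : G) (j : ℕ), 2 ≤ j → h ^ j ≠ g

/-- The primitive length spectrum of the modular surface `ℍ / PSL(2, ℤ)`, as a set. -/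
def primitiveLengthSpectrum : Set ℝ :=
  {L | ∃ g : PSL(2, ℤ), IsPrimitive g ∧ L ∈ closedGeodesicLengths g}

/-- `g` is hyperbolic: its trace, well defined up to sign, has absolute value greater than `2`. -/
def IsHyperbolic (g : PSL(2, ℤ)) : Prop :=
  ∃ A : SL(2, ℤ), (A : PSL(2, ℤ)) = g ∧ 2 < |(A : Matrix (Fin 2) (Fin 2) ℤ).trace|

/-- The group of units of norm one (over `ℚ`) of the ring of integers of a number field `K`. -/
def normOneUnits (K : Type*) [Field K] [Algebra ℚ K] : Subgroup (𝓞 K)ˣ where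
  carrier := {u | Algebra.norm ℚ ((u : 𝓞 K) : K) = 1}
  mul_mem' := by
    intro a b ha hb
    simp only [Set.mem_ofPred_eq] at ha hb ⊢
    simp [ha, hb]
  one_mem' := by simp
  inv_mem' := by
    intro a ha
    simp only [Set.mem_ofPred_eq] at ha ⊢
    have h : Algebra.norm ℚ ((a : 𝓞 K) : K) * Algebra.norm ℚ (((a⁻¹ : (𝓞 K)ˣ) : 𝓞 K) : K) = 1 := by
      rw [← map_mul, ← map_mul, ← Units.val_mul]
      simp
    simpa [ha] using h

/-- `x` is a fundamental unit in the group of norm-one units of the ring of integers of `ℚ(x)`: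
it belongs to this group, and together with `-1` it generates it. -/
def IsFundamentalNormOneUnit (x : ℝ) : Prop :=
  ∃ ε ∈ normOneUnits ℚ⟮x⟯, (((ε : 𝓞 ℚ⟮x⟯) : ℚ⟮x⟯) : ℝ) = x ∧
    ∀ u ∈ normOneUnits ℚ⟮x⟯, ∃ j : ℤ, u = ε ^ j ∨ u = -ε ^ j

/-- `g` is absolutely primitive: it is hyperbolic, and an eigenvalue of `g` is a fundamental unit
in the group of norm-one units of the real quadratic field it generates. The eigenvalue is well
defined up to sign and inversion, which do not affect the condition. -/
def IsAbsolutelyPrimitive (g : PSL(2, ℤ)) : Prop :=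
  IsHyperbolic g ∧
    ∃ A : SL(2, ℤ), (A : PSL(2, ℤ)) = g ∧
      ∃ x : ℝ, Polynomial.aeval x (A : Matrix (Fin 2) (Fin 2) ℤ).charpoly = 0 ∧
        IsFundamentalNormOneUnit x

/-- The class of the matrix `diag(1, m)` in `PGL(2, ℚ)`. -/
def diagOne (m : ℕ+) : PGL(2, ℚ) :=
  Matrix.ProjGenLinGroup.mk (.mkOfDetNeZero !![1, 0; 0, (m : ℚ)] (by simp))

end ModularSurface

end

namespace ModularSurface

open Matrix

/-! ### Isometries of the upper half-plane -/

/-! Let `M` be a positive power `γ ^ n` of a hyperbolic `γ`. Its upper right entry `b` is nonzero,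
and conjugation by `diag(1, |b|)` divides `b` by `|b|` and multiplies the lower left entry by `|b|`,
so the result is an integral matrix with upper right entry `±1`. Such a hyperbolic matrix is never a
proper power: by Cayley–Hamilton `B ^ j = u B + v`, so `u` divides the upper right entry, while `|u|
≥ 2` for `j ≥ 2` (`isPrimitive_of_isUnit_apply_zero_one`). Conjugation preserves translation length,
so every `nℓ` is a primitive length, and `C = D = 1` serve for all `k`. Lengths are found by
diagonalising over `ℝ`. They are unique because the displacement of `g ^ n` grows like `nL`. -/

lemma dist_coe_smul (g : GL (Fin 2) ℝ) (z w : ℍ) :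
    dist ((g • z : ℍ) : ℂ) (g • w : ℍ) =
      |g.det.val| * dist (z : ℂ) w /
        (‖UpperHalfPlane.denom g z‖ * ‖UpperHalfPlane.denom g w‖) := by
  have hz := UpperHalfPlane.denom_ne_zero g z
  have hw := UpperHalfPlane.denom_ne_zero g w
  rw [UpperHalfPlane.coe_smul, UpperHalfPlane.coe_smul, dist_eq_norm, dist_eq_norm, ← map_sub,
    UpperHalfPlane.norm_σ, div_sub_div _ _ hz hw, norm_div, norm_mul, ← Real.norm_eq_abs,
    ← Complex.norm_real]
  congr 1
  rw [← norm_mul]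
  congr 1
  rw [Matrix.GeneralLinearGroup.val_det_apply, Matrix.det_fin_two]
  simp only [UpperHalfPlane.num, UpperHalfPlane.denom]
  push_cast
  ring

instance isIsometricSMul_GL : IsIsometricSMul (GL (Fin 2) ℝ) ℍ where
  isometry_smul g := Isometry.of_dist_eq fun z w ↦ by
    have hz := UpperHalfPlane.denom_ne_zero g z
    have hw := UpperHalfPlane.denom_ne_zero g w
    have hd : |g.det.val| ≠ 0 := abs_ne_zero.2 g.det.ne_zero
    have hcosh : Real.cosh (dist (g • z) (g • w)) = Real.cosh (dist z w) := by
      rw [UpperHalfPlane.cosh_dist, UpperHalfPlane.cosh_dist, dist_coe_smul,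
        UpperHalfPlane.im_smul_eq_div_normSq, UpperHalfPlane.im_smul_eq_div_normSq,
        Complex.normSq_eq_norm_sq, Complex.normSq_eq_norm_sq]
      have h1 := norm_ne_zero_iff.2 hz
      have h2 := norm_ne_zero_iff.2 hw
      have h3 := z.im_ne_zero
      have h4 := w.im_ne_zero
      field_simp
    exact Real.cosh_strictMonoOn.injOn dist_nonneg dist_nonneg hcosh

instance isIsometricSMul_PGL : IsIsometricSMul PGL(2, ℝ) ℍ where
  isometry_smul g := by
    induction g using Matrix.ProjGenLinGroup.induction_on with | mk g =>
    simpa only [UpperHalfPlane.pglMk_smul] using isometry_smul ℍ g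

/-- The unit-speed parametrization `t ↦ i eᵗ` of the imaginary axis. -/
noncomputable def imaginaryAxis (t : ℝ) : ℍ := ⟨⟨0, Real.exp t⟩, Real.exp_pos t⟩

lemma isometry_imaginaryAxis : Isometry imaginaryAxis :=
  Isometry.of_dist_eq fun s t ↦ by
    rw [UpperHalfPlane.dist_of_re_eq (by rfl)]
    exact congr_arg₂ dist (Real.log_exp s) (Real.log_exp t)

/-- The matrix acts as the dilation `z ↦ (x / y) z`, since `0 < x / y` makes its determinant
positive. -/
lemma diagonal_smul_imaginaryAxis (g : GL (Fin 2) ℝ) {x y : ℝ} (hg : g.val = !![x, 0; 0, y])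
    (hxy : 0 < x / y) (t : ℝ) :
    g • imaginaryAxis t = imaginaryAxis (t + Real.log (x / y)) := by
  have hy : y ≠ 0 := by rintro rfl; simp at hxy
  have hdet : 0 < g.det.val := by
    rw [Matrix.GeneralLinearGroup.val_det_apply, hg, Matrix.det_fin_two_of]
    have : x * y = x / y * y ^ 2 := by field_simp
    rw [mul_zero, sub_zero, this]
    positivity
  apply UpperHalfPlane.ext
  rw [UpperHalfPlane.coe_smul_of_det_pos hdet]
  have h00 : g 0 0 = x := by simp [hg]
  have h01 : g 0 1 = 0 := by simp [hg]
  have h10 : g 1 0 = 0 := by simp [hg]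
  have h11 : g 1 1 = y := by simp [hg]
  simp only [UpperHalfPlane.num, UpperHalfPlane.denom, h00, h01, h10, h11, imaginaryAxis,
    Real.exp_add, Real.exp_log hxy]
  apply Complex.ext <;> simp [Complex.div_re, Complex.div_im, Complex.normSq_apply]
  field_simp

/-! ### Lengths of closed geodesics -/

lemma toPGL_coe (R : Type) [CommRing R] (A : SL(2, ℤ)) :
    toPGL R (A : PSL(2, ℤ)) =
      ProjGenLinGroup.mk
        (GeneralLinearGroup.map (Int.castRingHom R) (Matrix.SpecialLinearGroup.toGL A)) :=
  rfl

lemma apply_add_mul_eq_pow_smul {g : PGL(2, ℝ)} {L : ℝ} {c : ℝ → ℍ}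
    (h : ∀ t, c (t + L) = g • c t) (n : ℕ) (t : ℝ) : c (t + n * L) = g ^ n • c t := by
  induction n with
  | zero => simp
  | succ n ih =>
    rw [pow_succ', mul_smul, ← ih, ← h]
    push_cast
    ring_nf

/-- Any two translation lengths of `g` agree: compare the displacements of large powers of `g`. -/
lemma le_of_mem_closedGeodesicLengths {g : PSL(2, ℤ)} {L L' : ℝ}
    (h : L ∈ closedGeodesicLengths g) (h' : L' ∈ closedGeodesicLengths g) : L ≤ L' := by
  obtain ⟨hL, c, hc, hcg⟩ := h
  obtain ⟨hL', c', hc', hcg'⟩ := h'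
  by_contra! hlt
  have key (n : ℕ) : n * (L - L') ≤ 2 * dist (c 0) (c' 0) := by
    have e1 : dist (c 0) (toPGL ℝ g ^ n • c 0) = n * L := by
      rw [← apply_add_mul_eq_pow_smul hcg, hc.dist_eq, zero_add, Real.dist_eq, zero_sub, abs_neg,
        abs_of_nonneg (by positivity)]
    have e2 : dist (c' 0) (toPGL ℝ g ^ n • c' 0) = n * L' := by
      rw [← apply_add_mul_eq_pow_smul hcg', hc'.dist_eq, zero_add, Real.dist_eq, zero_sub, abs_neg,
        abs_of_nonneg (by positivity)]
    have e3 := dist_triangle4 (c 0) (c' 0) (toPGL ℝ g ^ n • c' 0) (toPGL ℝ g ^ n • c 0)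
    rw [dist_smul, dist_comm (c' 0) (c 0)] at e3
    linarith
  obtain ⟨n, hn⟩ := exists_nat_gt (2 * dist (c 0) (c' 0) / (L - L'))
  rw [div_lt_iff₀ (by linarith)] at hn
  exact absurd (key n) (not_le.2 hn)

lemma mul_mem_closedGeodesicLengths {g h : PSL(2, ℤ)} {p : PGL(2, ℝ)} {n : ℕ} {L : ℝ} (hn : 0 < n)
    (hgh : toPGL ℝ h = p * toPGL ℝ g ^ n * p⁻¹) (hL : L ∈ closedGeodesicLengths g) :
    n * L ∈ closedGeodesicLengths h := by
  obtain ⟨hL0, c, hc, hcg⟩ := hL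
  refine ⟨by positivity, fun t ↦ p • c t, (isometry_smul ℍ p).comp hc, fun t ↦ ?_⟩
  simp only [apply_add_mul_eq_pow_smul hcg, hgh, mul_smul, inv_smul_smul]

/-- The left side is unchanged by adding a scalar matrix and scales by `u ^ 2` under `A ↦ u A`.
Hence hyperbolicity passes between `B` and `u B + v` when `u ≠ 0`. -/
lemma discr_eq {A : SL(2, ℤ)} :
    (A 0 0 - A 1 1) ^ 2 + 4 * (A 0 1 * A 1 0) = (A 0 0 + A 1 1) ^ 2 - 4 := by
  have h := A.det_coe
  rw [Matrix.det_fin_two] at h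
  linear_combination -4 * h

lemma apply_zero_one_ne_zero {A : SL(2, ℤ)} (hA : 2 < |A 0 0 + A 1 1|) : A 0 1 ≠ 0 := by
  intro h0
  have h := A.det_coe
  rw [Matrix.det_fin_two, h0, zero_mul, sub_zero] at h
  rcases Int.mul_eq_one_iff_eq_one_or_neg_one.1 h with ⟨h1, h2⟩ | ⟨h1, h2⟩ <;>
    simp [h1, h2] at hA

/-- The roots of `X² - tX + 1` for `|t| > 2`, the one of larger absolute value first. -/
lemma exists_roots_of_two_lt_abs {t : ℝ} (ht : 2 < |t|) :
    ∃ x y : ℝ, x + y = t ∧ x * y = 1 ∧ 1 < x / y := by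
  wlog h0 : 0 < t generalizing t
  · have h0' : t < 0 := lt_of_le_of_ne (not_lt.1 h0) (by rintro rfl; simp at ht; linarith)
    obtain ⟨x, y, h1, h2, h3⟩ := this (t := -t) (by rwa [abs_neg]) (by linarith)
    exact ⟨-x, -y, by linarith, by linarith, by rwa [neg_div_neg_eq]⟩
  rw [abs_of_pos h0] at ht
  have hs : 0 < t ^ 2 - 4 := by nlinarith
  have hs' := Real.sqrt_pos.2 hs
  have hsq := Real.sq_sqrt hs.le
  have hlt : √(t ^ 2 - 4) < t := by nlinarith
  refine ⟨(t + √(t ^ 2 - 4)) / 2, (t - √(t ^ 2 - 4)) / 2, by ring, by linarith, ?_⟩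
  rw [one_lt_div (by linarith)]
  linarith

lemma closedGeodesicLengths_nonempty {A : SL(2, ℤ)} (hA : 2 < |A 0 0 + A 1 1|) :
    (closedGeodesicLengths (A : PSL(2, ℤ))).Nonempty := by
  have hb : (A 0 1 : ℝ) ≠ 0 := by exact_mod_cast apply_zero_one_ne_zero hA
  have hdet : (A 0 0 : ℝ) * A 1 1 - A 0 1 * A 1 0 = 1 := by
    have h := A.det_coe
    rw [Matrix.det_fin_two] at h
    exact_mod_cast h
  obtain ⟨x, y, hsum, hprod, hxy⟩ :=
    exists_roots_of_two_lt_abs (t := (A 0 0 : ℝ) + A 1 1) (by exact_mod_cast hA)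
  have hne : y - x ≠ 0 := by
    intro h
    rw [sub_eq_zero] at h
    subst h
    rw [div_self (left_ne_zero_of_mul_eq_one hprod)] at hxy
    exact lt_irrefl _ hxy
  let D : GL (Fin 2) ℝ := .mkOfDetNeZero !![x, 0; 0, y] (by simp [hprod])
  let P : GL (Fin 2) ℝ := .mkOfDetNeZero !![(A 0 1 : ℝ), A 0 1; x - A 0 0, y - A 0 0] (by
    rw [Matrix.det_fin_two_of]
    convert mul_ne_zero hb hne using 1
    ring)
  -- The columns of `P` are eigenvectors `(b, x - a)` and `(b, y - a)`, where `a`, `b` form the top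
  -- row of `A`. Its determinant `b (y - x)` may be negative; `P` is then an orientation-reversing
  -- isometry, which is harmless.
  have hAP : GeneralLinearGroup.map (Int.castRingHom ℝ) (Matrix.SpecialLinearGroup.toGL A) * P =
      P * D := by
    have hx : x ^ 2 = (A 0 0 + A 1 1 : ℝ) * x - 1 := by linear_combination x * hsum - hprod
    have hy : y ^ 2 = (A 0 0 + A 1 1 : ℝ) * y - 1 := by linear_combination y * hsum - hprod
    ext i j
    fin_cases i <;> fin_cases j <;>
      simp [P, D, Matrix.mul_apply, Fin.sum_univ_two, GeneralLinearGroup.mkOfDetNeZero]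
    · ring
    · ring
    · linear_combination -hdet - hx
    · linear_combination -hdet - hy
  refine ⟨Real.log (x / y), Real.log_pos hxy, fun t ↦ P • imaginaryAxis t,
    (isometry_smul ℍ P).comp isometry_imaginaryAxis, fun t ↦ ?_⟩
  rw [toPGL_coe, UpperHalfPlane.pglMk_smul, ← mul_smul, hAP, mul_smul,
    diagonal_smul_imaginaryAxis D rfl (by linarith)]

theorem IsHyperbolic.exists_closedGeodesicLengths_eq_singleton {g : PSL(2, ℤ)} (hg : IsHyperbolic g) :
    ∃ ℓ, closedGeodesicLengths g = {ℓ} := by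
  obtain ⟨A, rfl, hA⟩ := hg
  rw [Matrix.trace_fin_two] at hA
  obtain ⟨ℓ, hℓ⟩ := closedGeodesicLengths_nonempty hA
  exact ⟨ℓ, Set.Subset.antisymm (fun L hL ↦ (le_of_mem_closedGeodesicLengths hL hℓ).antisymm
    (le_of_mem_closedGeodesicLengths hℓ hL)) (Set.singleton_subset_iff.2 hℓ)⟩

/-! ### Powers and primitivity -/

/-- By Cayley–Hamilton, positive powers of `B` are combinations of `B` and `1`; the coefficient
of `B` grows with the exponent when `B` is hyperbolic. -/
lemma exists_pow_eq_smul_add (B : SL(2, ℤ)) (j : ℕ) :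
    ∃ u v : ℤ, ((B ^ (j + 1) : SL(2, ℤ)) : Matrix (Fin 2) (Fin 2) ℤ) =
        u • (B : Matrix (Fin 2) (Fin 2) ℤ) + v • 1 ∧
      (2 < |B 0 0 + B 1 1| → |v| < |u| ∧ (1 ≤ j → 2 ≤ |u|)) := by
  induction j with
  | zero => exact ⟨1, 0, by simp, fun _ ↦ by simp⟩
  | succ j ih =>
    obtain ⟨u, v, huv, hlt⟩ := ih
    refine ⟨u * (B 0 0 + B 1 1) + v, -u, ?_, fun ht ↦ ?_⟩
    · have h := B.det_coe
      rw [Matrix.det_fin_two] at h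
      rw [pow_succ, Matrix.SpecialLinearGroup.coe_mul, huv]
      ext i k
      fin_cases i <;> fin_cases k <;>
        simp [-zsmul_eq_mul, -zsmul_one, Matrix.mul_apply, Fin.sum_univ_two]
      · linear_combination -u * h
      · ring
      · ring
      · linear_combination -u * h
    -- Here `|tr B| ≥ 3`, so the new coefficient is at least `3|u| - |v| > 2|u|` in absolute value.
    · obtain ⟨h1, -⟩ := hlt ht
      have h2 : |u * (B 0 0 + B 1 1)| - |v| ≤ |u * (B 0 0 + B 1 1) + v| := by
        have := abs_sub_abs_le_abs_sub (u * (B 0 0 + B 1 1)) (-v)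
        rwa [abs_neg, sub_neg_eq_add] at this
      have h3 : |u| * 3 ≤ |u * (B 0 0 + B 1 1)| := by
        rw [abs_mul]
        exact mul_le_mul_of_nonneg_left (by omega) (abs_nonneg u)
      have h4 := abs_nonneg v
      rw [abs_neg]
      omega

/-- A hyperbolic matrix whose upper right entry is `±1` is not a proper power in `PSL(2, ℤ)`. -/
theorem isPrimitive_of_isUnit_apply_zero_one {T : SL(2, ℤ)} (hT : 2 < |T 0 0 + T 1 1|)
    (h01 : IsUnit (T 0 1)) : IsPrimitive (T : PSL(2, ℤ)) := by
  intro h j hj hpow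
  induction h using QuotientGroup.induction_on with | H B =>
  obtain ⟨i, rfl⟩ : ∃ i, j = i + 1 := ⟨j - 1, by omega⟩
  -- Equality in `PSL(2, ℤ)` means equality up to a central scalar `r`.
  rw [← QuotientGroup.mk_pow, QuotientGroup.eq, Matrix.SpecialLinearGroup.mem_center_iff] at hpow
  obtain ⟨r, -, hr⟩ := hpow
  obtain ⟨u, v, huv, hgrow⟩ := exists_pow_eq_smul_add B i
  have hTr : (T : Matrix (Fin 2) (Fin 2) ℤ) = (u * r) • (B : Matrix (Fin 2) (Fin 2) ℤ) +
      (v * r) • (1 : Matrix (Fin 2) (Fin 2) ℤ) := by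
    have : T = B ^ (i + 1) * ((B ^ (i + 1))⁻¹ * T) := by group
    conv_lhs => rw [this, Matrix.SpecialLinearGroup.coe_mul, huv, ← hr, Matrix.scalar_apply,
      ← Matrix.smul_one_eq_diagonal, mul_smul_comm, mul_one, smul_add, smul_smul, smul_smul,
      mul_comm r, mul_comm r]
  have e00 : T 0 0 = u * r * B 0 0 + v * r := by simpa [-zsmul_eq_mul, -zsmul_one] using congr_fun₂ hTr 0 0
  have e01 : T 0 1 = u * r * B 0 1 := by simpa [-zsmul_eq_mul, -zsmul_one] using congr_fun₂ hTr 0 1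
  have e10 : T 1 0 = u * r * B 1 0 := by simpa [-zsmul_eq_mul, -zsmul_one] using congr_fun₂ hTr 1 0
  have e11 : T 1 1 = u * r * B 1 1 + v * r := by simpa [-zsmul_eq_mul, -zsmul_one] using congr_fun₂ hTr 1 1
  have hdisc : (T 0 0 + T 1 1) ^ 2 - 4 = (u * r) ^ 2 * ((B 0 0 + B 1 1) ^ 2 - 4) := by
    rw [← discr_eq, ← discr_eq, e00, e01, e10, e11]
    ring
  -- The growth bound needs `B` hyperbolic; its discriminant is positive because that of `T` is.
  have hB : 2 < |B 0 0 + B 1 1| := by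
    have h1 : (2 : ℤ) ^ 2 < (T 0 0 + T 1 1) ^ 2 := sq_lt_sq.2 (by simpa using hT)
    have h2 : 0 < (B 0 0 + B 1 1) ^ 2 - 4 :=
      pos_of_mul_pos_right (by linarith) (sq_nonneg (u * r))
    have h3 : (2 : ℤ) ^ 2 < (B 0 0 + B 1 1) ^ 2 := by linarith
    simpa using sq_lt_sq.1 h3
  have hu : IsUnit u := by
    rw [e01] at h01
    exact isUnit_of_mul_isUnit_left (isUnit_of_mul_isUnit_left h01)
  have := (hgrow hB).2 (by omega)
  rw [Int.isUnit_iff_abs_eq.1 hu] at this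
  omega

/-- Conjugating a positive power of a hyperbolic element by `diag(1, m)`, where `m` is the absolute
value of its upper right entry, gives a primitive element of `PSL(2, ℤ)`. -/
theorem IsHyperbolic.exists_isPrimitive_conj {g : PSL(2, ℤ)} (hg : IsHyperbolic g) {n : ℕ}
    (hn : 0 < n) : ∃ (m : ℕ+) (θ : PSL(2, ℤ)),
      toPGL ℚ θ = diagOne m * toPGL ℚ g ^ n * (diagOne m)⁻¹ ∧ IsPrimitive θ := by
  obtain ⟨A, rfl, hA⟩ := hg
  rw [Matrix.trace_fin_two] at hA
  obtain ⟨i, rfl⟩ : ∃ i, n = i + 1 := ⟨n - 1, by omega⟩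
  obtain ⟨u, v, huv, hgrow⟩ := exists_pow_eq_smul_add A i
  have hu : u ≠ 0 := abs_pos.1 ((abs_nonneg v).trans_lt (hgrow hA).1)
  generalize hM : A ^ (i + 1) = M at huv
  have e00 : M 0 0 = u * A 0 0 + v := by simpa [-zsmul_eq_mul, -zsmul_one] using congr_fun₂ huv 0 0
  have e01 : M 0 1 = u * A 0 1 := by simpa [-zsmul_eq_mul, -zsmul_one] using congr_fun₂ huv 0 1
  have e10 : M 1 0 = u * A 1 0 := by simpa [-zsmul_eq_mul, -zsmul_one] using congr_fun₂ huv 1 0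
  have e11 : M 1 1 = u * A 1 1 + v := by simpa [-zsmul_eq_mul, -zsmul_one] using congr_fun₂ huv 1 1
  have hb : M 0 1 ≠ 0 := by
    rw [e01]
    exact mul_ne_zero hu (apply_zero_one_ne_zero hA)
  have htr : 2 < |M 0 0 + M 1 1| := by
    have hdisc : (M 0 0 + M 1 1) ^ 2 - 4 = u ^ 2 * ((A 0 0 + A 1 1) ^ 2 - 4) := by
      rw [← discr_eq, ← discr_eq, e00, e01, e10, e11]
      ring
    have h1 : (2 : ℤ) ^ 2 < (A 0 0 + A 1 1) ^ 2 := sq_lt_sq.2 (by simpa using hA)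
    have h2 : 0 < u ^ 2 * ((A 0 0 + A 1 1) ^ 2 - 4) :=
      mul_pos (by positivity) (by linarith)
    have h3 : (2 : ℤ) ^ 2 < (M 0 0 + M 1 1) ^ 2 := by linarith
    simpa using sq_lt_sq.1 h3
  let m : ℕ+ := ⟨(M 0 1).natAbs, Int.natAbs_pos.2 hb⟩
  have hm : (M 0 1).sign * ((m : ℕ) : ℤ) = M 0 1 := Int.sign_mul_natAbs _
  have hmQ : (((M 0 1).sign : ℤ) : ℚ) * ((m : ℕ) : ℚ) = (M 0 1 : ℚ) := by exact_mod_cast hm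
  -- This is `diag(1, m) M diag(1, m)⁻¹` written out, with `M 0 1 / m` replaced by the sign of `M 0
  -- 1`.
  obtain ⟨T, hT⟩ : ∃ T : SL(2, ℤ), (T : Matrix (Fin 2) (Fin 2) ℤ) =
      !![M 0 0, (M 0 1).sign; ((m : ℕ) : ℤ) * M 1 0, M 1 1] := by
    refine ⟨⟨_, ?_⟩, rfl⟩
    have h := M.det_coe
    rw [Matrix.det_fin_two] at h
    rw [Matrix.det_fin_two_of]
    linear_combination h - M 1 0 * hm
  refine ⟨m, T, ?_, isPrimitive_of_isUnit_apply_zero_one (by simpa [hT] using htr) ?_⟩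
  · rw [eq_mul_inv_iff_mul_eq, ← map_pow, ← QuotientGroup.mk_pow, hM, toPGL_coe, toPGL_coe, diagOne,
      ← map_mul, ← map_mul]
    congr 1
    ext a b
    fin_cases a <;> fin_cases b <;>
      simp [hT, Matrix.mul_apply, Fin.sum_univ_two, GeneralLinearGroup.mkOfDetNeZero, ← hmQ,
        mul_comm]
  · rcases lt_or_gt_of_ne hb with h | h
    · simp [hT, Int.sign_eq_neg_one_of_neg h]
    · simp [hT, Int.sign_eq_one_of_pos h]

/-- The conjugation takes place in `PGL(2, ℚ)`, but lengths are read off from the real action on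
`ℍ`. -/
lemma toPGL_real_eq_map (g : PSL(2, ℤ)) :
    toPGL ℝ g = ProjGenLinGroup.map (Rat.castHom ℝ) (toPGL ℚ g) := by
  simp only [toPGL, MonoidHom.comp_apply]
  rw [← MonoidHom.comp_apply (ProjGenLinGroup.map (Rat.castHom ℝ)), ← ProjGenLinGroup.map_comp]
  congr 2

/-- Every positive integral multiple of the length of a hyperbolic element is the length of a
primitive element obtained from a power of it by conjugation in `PGL(2, ℚ)`. -/
theorem IsHyperbolic.exists_isPrimitive_conj_length {g : PSL(2, ℤ)} (hg : IsHyperbolic g) {ℓ : ℝ}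
    (hℓ : ℓ ∈ closedGeodesicLengths g) {n : ℕ} (hn : 0 < n) :
    ∃ (m : ℕ+) (θ : PSL(2, ℤ)),
      toPGL ℚ θ = diagOne m * toPGL ℚ g ^ n * (diagOne m)⁻¹ ∧ IsPrimitive θ ∧
        n * ℓ ∈ closedGeodesicLengths θ := by
  obtain ⟨m, θ, hθ, hprim⟩ := hg.exists_isPrimitive_conj hn
  refine ⟨m, θ, hθ, hprim, mul_mem_closedGeodesicLengths
    (p := ProjGenLinGroup.map (Rat.castHom ℝ) (diagOne m)) hn ?_ hℓ⟩
  rw [toPGL_real_eq_map, toPGL_real_eq_map, hθ, map_mul, map_mul, map_pow, map_inv]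

end ModularSurface

theorem mainTheorem9 :
    (∀ γ : PSL(2, ℤ), ModularSurface.IsAbsolutelyPrimitive γ →
      ∃ ℓ : ℝ, ModularSurface.closedGeodesicLengths γ = {ℓ} ∧
        ∀ k : ℕ, ∃ C : ℕ, 0 < C ∧
          ∀ n : ℕ, 1 ≤ n → n ≤ k →
            (C : ℝ) * ℓ * n ∈ ModularSurface.primitiveLengthSpectrum ∧
            ∃ (m : ℕ+) (θ : PSL(2, ℤ)),
              ModularSurface.toPGL ℚ θ =
                ModularSurface.diagOne m * ModularSurface.toPGL ℚ γ ^ (C * n) *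
                  (ModularSurface.diagOne m)⁻¹ ∧
              ModularSurface.IsPrimitive θ ∧
              (C : ℝ) * ℓ * n ∈ ModularSurface.closedGeodesicLengths θ) ∧
    (∀ γ : PSL(2, ℤ), ModularSurface.IsHyperbolic γ → ModularSurface.IsPrimitive γ →
      ∃ ℓ : ℝ, ModularSurface.closedGeodesicLengths γ = {ℓ} ∧
        ∃ D : ℕ, 0 < D ∧
          ∀ k : ℕ, ∃ C : ℚ, 0 < C ∧ (∃ N : ℕ, C * D = N) ∧
            ∀ n : ℕ, 1 ≤ n → n ≤ k →
              (C : ℝ) * ℓ * n ∈ ModularSurface.primitiveLengthSpectrum) := by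
  refine ⟨fun γ hγ ↦ ?_, fun γ hγ _ ↦ ?_⟩
  · obtain ⟨ℓ, hℓ⟩ := hγ.1.exists_closedGeodesicLengths_eq_singleton
    refine ⟨ℓ, hℓ, fun k ↦ ⟨1, one_pos, fun n hn _ ↦ ?_⟩⟩
    obtain ⟨m, θ, hθ, hprim, hlen⟩ :=
      hγ.1.exists_isPrimitive_conj_length (hℓ ▸ Set.mem_singleton ℓ) hn
    have hlen' : ((1 : ℕ) : ℝ) * ℓ * n ∈ ModularSurface.closedGeodesicLengths θ := by
      rwa [Nat.cast_one, one_mul, mul_comm]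
    exact ⟨⟨θ, hprim, hlen'⟩, m, θ, by rwa [one_mul], hprim, hlen'⟩
  · obtain ⟨ℓ, hℓ⟩ := hγ.exists_closedGeodesicLengths_eq_singleton
    refine ⟨ℓ, hℓ, 1, one_pos, fun k ↦ ⟨1, one_pos, ⟨1, by simp⟩, fun n hn _ ↦ ?_⟩⟩
    obtain ⟨m, θ, hθ, hprim, hlen⟩ :=
      hγ.exists_isPrimitive_conj_length (hℓ ▸ Set.mem_singleton ℓ) hn
    exact ⟨θ, hprim, by rwa [Rat.cast_one, one_mul, mul_comm]⟩
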